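/- Let $\mathbf k$ be a field, $\Lambda$ a finite-dimensional $\mathbf k$-algebra, and $Q$ a finite acyclic quiver with vertex set $Q_0$. Let $\operatorname{mod}\Lambda$ be the category of finite-dimensional $\Lambda$-modules, $\operatorname{proj}\Lambda$ its full subcategory of projective modules, and let $\operatorname{mod}\Lambda Q=[Q,\operatorname{mod}\Lambda]$ be the category of (covariant) representations of $Q$ in $\operatorname{mod}\Lambda$, that is, of functors from the free category on $Q$ to $\operatorname{mod}\Lambda$; in particular this defines $\operatorname{mod}\mathbf kQ$. For $M\in\operatorname{mod}\Lambda Q$ let $M_\Lambda=\bigoplus_{i\in Q_0}M_i$ be the underlying $\Lambda$-module, and let $M_{\mathbf kQ}\in\operatorname{mod}\mathbf kQ$ be $M$ with only the $\mathbf k$-linear structure of each $M_i$ retained. For $i\in Q_0$ and $A\in\operatorname{mod}\Lambda$ let $\mathsf I_i(A)\in\operatorname{mod}\Lambda Q$ be the representation with $$\mathsf I_i(A)_j=\bigoplus_{\rho\colon j\leadsto i}A^{(\rho)}\qquad(\rho\text{ running over the paths from } j \text{ to } i),$$ in which an arrow $\alpha\colon j\to l$ maps the summand $A^{(\rho\alpha)}$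 identically to $A^{(\rho)}$ for each path $\rho\colon l\leadsto i$, and maps all other summands to zero. Let $$\mathbb T=\operatorname{add}\{\mathsf I_i(P)\mid i\in Q_0,\ P\in\operatorname{proj}\Lambda\},$$ the full subcategory of all direct summands of finite direct sums of such objects. Then there is an equivalence of ($\mathbf k$-linear) categories $$\frac{\{M\in\operatorname{mod}\Lambda Q\mid M_\Lambda\in\operatorname{proj}\Lambda\}}{\mathbb T}\;\simeq\;\{M\in\operatorname{mod}\Lambda Q\mid M_{\mathbf kQ}\text{ has no nonzero injective direct summands in }\operatorname{mod}\mathbf kQ\}.$$ Both subcategories of $\operatorname{mod}\Lambda Q$ are full, and the left-hand side is the additive quotient: it has the same objects as the numerator, and two parallel morphisms are identified when their difference factors through an object of $\mathbb T$. -/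

import Mathlib

open CategoryTheory CategoryTheory.Limits

universe u

noncomputable section

namespace QuiverRep

/-! ### Finite acyclic quivers -/

/-- A quiver is acyclic if it has no oriented cycles: the only path from a vertex to itself
is the trivial one. -/
class IsAcyclic (Q : Type u) [Quiver.{u} Q] : Prop where
  eq_nil : ∀ (i : Q) (p : Quiver.Path i i), p = Quiver.Path.nil

/-- A finite acyclic quiver has only finitely many paths between any two vertices. -/
instance finite_path (Q : Type u) [Quiver.{u} Q] [Finite Q] [∀ i j : Q, Finite (i ⟶ j)]
    [IsAcyclic Q] (i j : Q) : Finite (Quiver.Path i j) := by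
  let r : Q → Q → Prop := fun a b => ∃ p : Quiver.Path a b, p.length ≠ 0
  have : IsTrans Q r := ⟨fun a b c ⟨p, hp⟩ ⟨q, _⟩ =>
    ⟨p.comp q, by rw [Quiver.Path.length_comp]; omega⟩⟩
  have : Std.Irrefl r := ⟨fun a ⟨p, hp⟩ => hp (by rw [IsAcyclic.eq_nil a p]; rfl)⟩
  have wf : WellFounded r := Finite.wellFounded_of_trans_of_irrefl r
  induction j using wf.induction with
  | _ j ih =>
    have : ∀ c : Q, Finite (Quiver.Path i c × (c ⟶ j)) := fun c => by
      rcases isEmpty_or_nonempty (c ⟶ j) with h | ⟨⟨e⟩⟩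
      · infer_instance
      · have := ih c ⟨e.toPath, by simp [Quiver.Hom.toPath]⟩
        infer_instance
    let f : (PLift (i = j)) ⊕ (Σ c : Q, Quiver.Path i c × (c ⟶ j)) → Quiver.Path i j
      | Sum.inl h => h.down ▸ Quiver.Path.nil
      | Sum.inr x => x.2.1.cons x.2.2
    refine Finite.of_surjective f fun p => ?_
    cases p with
    | nil => exact ⟨Sum.inl ⟨rfl⟩, rfl⟩
    | cons p e => exact ⟨Sum.inr ⟨_, p, e⟩, rfl⟩

/-- The same fact, for a vertex regarded as an object of the free category on `Q`. -/
instance finite_paths_hom (Q : Type u) [Quiver.{u} Q] [Finite Q] [∀ i j : Q, Finite (i ⟶ j)]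
    [IsAcyclic Q] (j : Paths Q) (i : Q) : Finite (Quiver.Path (V := Q) j i) :=
  finite_path Q j i

/-! ### Representations of a quiver in finitely generated modules -/

/-- The category `mod ΛQ = [Q, mod Λ]` of (covariant) representations of the quiver `Q` in the
category `mod Λ` of finitely generated `Λ`-modules: functors from the free category on `Q`. -/
abbrev ModQ (Λ : Type u) [Ring Λ] (Q : Type u) [Quiver.{u} Q] :=
  Paths Q ⥤ FGModuleCat.{u} Λ

section Algebra

variable (Λ : Type u) [Ring Λ] {Q : Type u} [Quiver.{u} Q]

/-- The `Λ`-module `M_Λ` underlying `M ∈ mod ΛQ`, namely the (finite) direct sum of the modules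
sitting at the vertices. -/
abbrev underlying (M : ModQ Λ Q) : Type u :=
  ∀ i : Paths Q, M.obj i

/-- The objects `M` of `mod ΛQ` such that `M_Λ` is projective. -/
def projUnderlying (Q : Type u) [Quiver.{u} Q] : ObjectProperty (ModQ Λ Q) :=
  fun M => Module.Projective Λ (underlying Λ M)

variable {Λ}
variable [Finite Q] [∀ i j : Q, Finite (i ⟶ j)] [IsAcyclic Q]

/-- The representation `I_i(A)` for a vertex `i` and a finitely generated module `A`. At the
vertex `j` it is `⨁_{ρ : j ⇝ i} A`, written as functions on the finite set of paths from `j`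
to `i`. A path `σ : j ⇝ l` acts by sending the summand at `ρσ` (first `σ`, then `ρ`)
identically to the summand at `ρ : l ⇝ i`, and all the other summands to zero. -/
def coind (i : Q) (A : FGModuleCat.{u} Λ) : ModQ Λ Q where
  obj j := FGModuleCat.of Λ (Quiver.Path (V := Q) j i → A)
  map {j l} σ := FGModuleCat.ofHom
    (LinearMap.funLeft Λ A (fun ρ : Quiver.Path (V := Q) l i => Quiver.Path.comp σ ρ))
  map_id j := by
    ext x ρ
    exact congrArg x (Quiver.Path.nil_comp ρ)
  map_comp {j l m} σ τ := by
    ext x ρ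
    exact congrArg x (Quiver.Path.comp_assoc σ τ ρ)

end Algebra

/-! ### Additive closure and additive quotients -/

section Additive

variable {C : Type*} [Category* C] [Preadditive C]

/-- `add P`: the direct summands of finite direct sums of objects satisfying `P`. -/
def addClosure (P : ObjectProperty C) : ObjectProperty C :=
  fun X => ∃ (n : ℕ) (F : Fin n → C) (b : Bicone F),
    (∀ a, P (F a)) ∧ Nonempty b.IsBilimit ∧ Nonempty (Retract X b.pt)

/-- Two parallel morphisms are identified in the additive quotient by `P` if their difference
factors through an object satisfying `P`. -/
def factorRel (P : ObjectProperty C) : HomRel C :=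
  fun X Y f g => ∃ (Z : C) (_ : P Z) (a : X ⟶ Z) (b : Z ⟶ Y), f - g = a ≫ b

/-- The additive quotient category `C / P`. -/
abbrev AdditiveQuotient (P : ObjectProperty C) := CategoryTheory.Quotient (factorRel P)

end Additive

/-! ### The two subcategories -/

section Main

variable (k : Type u) [Field k] (Λ : Type u) [Ring Λ] [Algebra k Λ]

/-- The objects `I_i(P)` with `i` a vertex and `P` a finitely generated projective module. -/
def coindProj (Q : Type u) [Quiver.{u} Q] [Finite Q] [∀ i j : Q, Finite (i ⟶ j)] [IsAcyclic Q] :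
    ObjectProperty (ModQ Λ Q) :=
  fun M => ∃ (i : Q) (P : FGModuleCat.{u} Λ), Module.Projective Λ P ∧ M = coind i P

/-- The subcategory `𝕋 = add {I_i(P) : i a vertex, P ∈ proj Λ}`. -/
def tilt (Q : Type u) [Quiver.{u} Q] [Finite Q] [∀ i j : Q, Finite (i ⟶ j)] [IsAcyclic Q] :
    ObjectProperty (ModQ Λ Q) :=
  addClosure (coindProj Λ Q)

/-- The restriction functor `mod Λ ⥤ mod k`, for a finite-dimensional `k`-algebra `Λ`. -/
def restrict [Module.Finite k Λ] : FGModuleCat.{u} Λ ⥤ FGModuleCat.{u} k :=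
  ObjectProperty.lift _
    (ObjectProperty.ι _ ⋙ ModuleCat.restrictScalars.{u} (algebraMap k Λ))
    (fun M => by
      let _ : Module k M := Module.restrictScalars k Λ M
      have : IsScalarTower k Λ M := IsScalarTower.restrictScalars k Λ M
      exact (Module.Finite.trans Λ M : Module.Finite k M))

/-- The forgetful functor `mod ΛQ ⥤ mod kQ`, `M ↦ M_{kQ}`. -/
def restrictQ [Module.Finite k Λ] (Q : Type u) [Quiver.{u} Q] : ModQ Λ Q ⥤ ModQ k Q :=
  (Functor.whiskeringRight (Paths Q) _ _).obj (restrict k Λ)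

/-- An object has no nonzero injective direct summands. -/
def noInjSummands {C : Type*} [Category* C] [HasZeroMorphisms C] : ObjectProperty C :=
  fun N => ∀ I : C, Injective I → Nonempty (Retract I N) → IsZero I

/-- The objects `M` of `mod ΛQ` such that `M_{kQ}` has no nonzero injective summands. -/
def noInjUnderlying [Module.Finite k Λ] (Q : Type u) [Quiver.{u} Q] :
    ObjectProperty (ModQ Λ Q) :=
  (noInjSummands (C := ModQ k Q)).inverseImage (restrictQ k Λ Q)

/-- The additive quotient `{M ∈ mod ΛQ : M_Λ projective} / 𝕋`. -/
abbrev ProjModTilt (Q : Type u) [Quiver.{u} Q] [Finite Q] [∀ i j : Q, Finite (i ⟶ j)]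
    [IsAcyclic Q] :=
  AdditiveQuotient ((tilt Λ Q).inverseImage (projUnderlying Λ Q).ι)

/-- The canonical functor from `{M ∈ mod ΛQ : M_Λ projective}` to its additive quotient by `𝕋`. -/
abbrev toProjModTilt (Q : Type u) [Quiver.{u} Q] [Finite Q] [∀ i j : Q, Finite (i ⟶ j)]
    [IsAcyclic Q] : (projUnderlying Λ Q).FullSubcategory ⥤ ProjModTilt Λ Q :=
  CategoryTheory.Quotient.functor _

end Main

end QuiverRep

end

/-! Call `X` arrow-surjective if each map from `X_i` to the product of the `X_j` over all arrows out
of `i` is onto. Over a field this means injective; over `Λ`, the objects of `𝕋` are exactly the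
vertexwise projective arrow-surjective representations. In both cases a suitable map into `X`
extends by recursion from the sinks, so `X` splits off the coinduced representation `coindProd`.
Sums and images of arrow-surjective families are arrow-surjective, so each `X` has a largest such
subrepresentation, `trace X`. The condition sees only additive groups, hence `trace` does not change
on restriction to `k`, and `M_{kQ}` has no nonzero injective summand iff `trace M = 0`
(`noInjUnderlying_iff`). The equivalence is induced by `M ↦ M / trace M`. Its properties rest on the
relative notion: vertexwise projectives lift along relatively arrow-surjective maps
(`RelArrowSurjective.exists_lift`), such maps pull the trace back to the trace
(`RelArrowSurjective.mem_trace_iff`), and every representation has a vertexwise projective cover of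
this kind (`exists_cover`). Fullness lifts along `Y ⟶ Y / trace Y`; a map into `trace Y` lifts to a
cover of `trace Y`, which lies in `𝕋`; and if `trace Y = 0`, a cover `P ⟶ Y` has kernel `trace P`,
so `P / trace P ≅ Y`. -/

noncomputable section

namespace QuiverRep

/-! ### Elementwise description of representations -/

section Basic

variable {Λ : Type u} [Ring Λ] {Q : Type u} [Quiver.{u} Q]

/-- The arrows of `Q`, between vertices regarded as objects of the free category. -/
abbrev Arr (i j : Paths Q) : Type u := Quiver.Hom (V := Q) i j

/-- An arrow, as a morphism of the free category. -/
def edge {i j : Paths Q} (α : Arr i j) : i ⟶ j := Quiver.Hom.toPath (V := Q) α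

instance [h : Finite Q] : Finite (Paths Q) := h

instance [h : ∀ i j : Q, Finite (i ⟶ j)] (i j : Paths Q) : Finite (Arr i j) := h i j

/-- The linear map by which a path acts on a representation. -/
def act (X : ModQ Λ Q) {i j : Paths Q} (σ : i ⟶ j) : X.obj i →ₗ[Λ] X.obj j :=
  (X.map σ).hom.hom

/-- The component at a vertex of a morphism of representations. -/
def comp {X Y : ModQ Λ Q} (f : X ⟶ Y) (i : Paths Q) : X.obj i →ₗ[Λ] Y.obj i :=
  (f.app i).hom.hom

lemma act_id (X : ModQ Λ Q) (i : Paths Q) (x : X.obj i) : act X (𝟙 i) x = x := by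
  have := congrArg (fun g => g.hom.hom x) (X.map_id i)
  exact this

lemma act_comp (X : ModQ Λ Q) {i j l : Paths Q} (σ : i ⟶ j) (τ : j ⟶ l) (x : X.obj i) :
    act X (σ ≫ τ) x = act X τ (act X σ x) := by
  have := congrArg (fun g => g.hom.hom x) (X.map_comp σ τ)
  exact this

lemma comp_act {X Y : ModQ Λ Q} (f : X ⟶ Y) {i j : Paths Q} (σ : i ⟶ j) (x : X.obj i) :
    comp f j (act X σ x) = act Y σ (comp f i x) := by
  have := congrArg (fun g => g.hom.hom x) (f.naturality σ)
  exact this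

lemma comp_comp {X Y Z : ModQ Λ Q} (f : X ⟶ Y) (g : Y ⟶ Z) (i : Paths Q) (x : X.obj i) :
    comp (f ≫ g) i x = comp g i (comp f i x) := rfl

lemma comp_id {X : ModQ Λ Q} (i : Paths Q) (x : X.obj i) : comp (𝟙 X) i x = x := rfl

lemma comp_add {X Y : ModQ Λ Q} (f g : X ⟶ Y) (i : Paths Q) (x : X.obj i) :
    comp (f + g) i x = comp f i x + comp g i x := rfl

lemma comp_zero {X Y : ModQ Λ Q} (i : Paths Q) (x : X.obj i) :
    comp (0 : X ⟶ Y) i x = 0 := rfl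

lemma comp_sum {X Y : ModQ Λ Q} {ι : Type*} (s : Finset ι) (f : ι → (X ⟶ Y)) (i : Paths Q)
    (x : X.obj i) : comp (∑ a ∈ s, f a) i x = ∑ a ∈ s, comp (f a) i x := by
  classical
  induction s using Finset.induction_on with
  | empty => simp [comp_zero]
  | insert a s ha ih => rw [Finset.sum_insert ha, Finset.sum_insert ha, comp_add, ih]

lemma hom_ext {X Y : ModQ Λ Q} {f g : X ⟶ Y} (h : ∀ i x, comp f i x = comp g i x) : f = g := by
  apply NatTrans.ext
  funext i
  exact FGModuleCat.hom_ext (LinearMap.ext (h i))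

lemma path_induction {P : ∀ {i j : Paths Q}, (i ⟶ j) → Prop} (hid : ∀ i, P (𝟙 i))
    (hcomp : ∀ {i j l : Paths Q} (σ : i ⟶ j) (α : Arr j l), P σ → P (σ ≫ edge α))
    {i j : Paths Q} (σ : i ⟶ j) : P σ :=
  Paths.induction (V := Q) P (fun {v} => hid v) (fun p q h => hcomp p q h) σ

/-- A morphism of representations is a family of linear maps compatible with all arrows. -/
def mkHom {X Y : ModQ Λ Q} (g : ∀ i, X.obj i →ₗ[Λ] Y.obj i)
    (h : ∀ {i j : Paths Q} (α : Arr i j) (x : X.obj i),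
      g j (act X (edge α) x) = act Y (edge α) (g i x)) : X ⟶ Y where
  app i := ConcreteCategory.ofHom (g i)
  naturality i j σ := by
    have : ∀ x : X.obj i, g j (act X σ x) = act Y σ (g i x) := by
      refine path_induction (P := fun {i j} σ => ∀ x : X.obj i, g j (act X σ x) = act Y σ (g i x))
        ?_ ?_ σ
      · intro i x
        rw [act_id, act_id]
      · intro i j l σ α ih x
        rw [act_comp, act_comp, h, ih]
    exact FGModuleCat.hom_ext (LinearMap.ext this)

/-- The representation with given modules at the vertices and given maps along the arrows. -/
def mkRep (obj : Paths Q → FGModuleCat.{u} Λ)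
    (map : ∀ i j : Paths Q, Arr i j → (obj i →ₗ[Λ] obj j)) : ModQ Λ Q :=
  Paths.lift (V := Q) { obj := obj, map := fun {i j} α => ConcreteCategory.ofHom (map i j α) }

lemma act_mkRep (obj : Paths Q → FGModuleCat.{u} Λ)
    (map : ∀ i j : Paths Q, Arr i j → (obj i →ₗ[Λ] obj j)) {i j : Paths Q} (α : Arr i j)
    (x : obj i) : act (mkRep obj map) (edge α) x = map i j α x := by
  have := Paths.lift_toPath (V := Q)
    { obj := obj, map := fun {i j} α => ConcreteCategory.ofHom (map i j α) } α
  have := congrArg (fun g => g.hom.hom x) this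
  exact this

lemma isIso_of_bijective {X Y : ModQ Λ Q} (f : X ⟶ Y)
    (h : ∀ i, Function.Bijective (comp f i)) : IsIso f := by
  let e := fun i => LinearEquiv.ofBijective (comp f i) (h i)
  let g : Y ⟶ X := mkHom (fun i => (e i).symm.toLinearMap) (by
    intro i j α y
    obtain ⟨x, rfl⟩ := (e i).surjective y
    have : act Y (edge α) (e i x) = e j (act X (edge α) x) := (comp_act f _ x).symm
    simp [this])
  refine ⟨g, hom_ext fun i x => ?_, hom_ext fun i x => ?_⟩
  · exact (e i).symm_apply_apply x
  · exact (e i).apply_symm_apply x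

end Basic

/-! ### Recursion from the sinks of an acyclic quiver -/

section Recursion

variable {Q : Type u} [Quiver.{u} Q] [Finite Q] [IsAcyclic Q]

lemma wellFounded_hom : WellFounded (fun j i : Q => Nonempty (i ⟶ j)) := by
  -- Nontrivial paths give a transitive relation containing the arrows; acyclicity makes it
  -- irreflexive, and finiteness then gives well-foundedness.
  let r : Q → Q → Prop := fun j i => ∃ p : Quiver.Path i j, p.length ≠ 0
  have : IsTrans Q r := ⟨fun a b c ⟨p, hp⟩ ⟨q, _⟩ =>
    ⟨q.comp p, by rw [Quiver.Path.length_comp]; omega⟩⟩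
  have : Std.Irrefl r := ⟨fun a ⟨p, hp⟩ => hp (by rw [IsAcyclic.eq_nil a p]; rfl)⟩
  refine Subrelation.wf (r := r) ?_ (Finite.wellFounded_of_trans_of_irrefl r)
  rintro j i ⟨α⟩
  exact ⟨α.toPath, by simp [Quiver.Hom.toPath]⟩

lemma wellFounded_arr : WellFounded (fun j i : Paths Q => Nonempty (Arr i j)) :=
  wellFounded_hom (Q := Q)

/-- A choice of data at the vertices of a finite acyclic quiver, each subject to a condition
depending on the data at the ends of the outgoing arrows. -/
lemma exists_sink_recursion (C : Paths Q → Type*)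
    (R : ∀ i, C i → (∀ j, Arr i j → C j) → Prop)
    (step : ∀ i (c : ∀ j, Arr i j → C j), ∃ x : C i, R i x c) :
    ∃ c : ∀ i, C i, ∀ i, R i (c i) (fun j _ => c j) := by
  let F : ∀ i, (∀ j, Nonempty (Arr i j) → C j) → C i := fun i rec =>
    (step i (fun j α => rec j ⟨α⟩)).choose
  refine ⟨wellFounded_arr.fix F, fun i => ?_⟩
  have h := wellFounded_arr.fix_eq F i
  rw [h]
  exact (step i (fun j _ => wellFounded_arr.fix F j)).choose_spec

end Recursion

/-! ### Relative surjectivity, liftings and extensions -/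

section Lifting

variable {Λ : Type u} [Ring Λ] {Q : Type u} [Quiver.{u} Q]

/-- `X` is arrow-surjective if every `X_i ⟶ ∏_{α : i ⟶ j} X_j` is surjective. -/
def ArrowSurjective (X : ModQ Λ Q) : Prop :=
  ∀ (i : Paths Q) (y : ∀ j, Arr i j → X.obj j), ∃ x : X.obj i, ∀ j α, act X (edge α) x = y j α

/-- `p : N ⟶ Y` is relatively arrow-surjective if every map from `N_i` to the fibre product of
`Y_i` and `∏_{α : i ⟶ j} N_j` over `∏_{α : i ⟶ j} Y_j` is surjective. -/
def RelArrowSurjective {N Y : ModQ Λ Q} (p : N ⟶ Y) : Prop :=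
  ∀ (i : Paths Q) (y : Y.obj i) (n : ∀ j, Arr i j → N.obj j),
    (∀ j α, comp p j (n j α) = act Y (edge α) y) →
      ∃ x : N.obj i, comp p i x = y ∧ ∀ j α, act N (edge α) x = n j α

lemma exists_comp_eq_of_range_le {P A B : Type*} [AddCommGroup P] [Module Λ P]
    [AddCommGroup A] [Module Λ A] [AddCommGroup B] [Module Λ B] [Module.Projective Λ P]
    (φ : A →ₗ[Λ] B) (ψ : P →ₗ[Λ] B) (h : ∀ x, ∃ a, φ a = ψ x) :
    ∃ g : P →ₗ[Λ] A, ∀ x, φ (g x) = ψ x := by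
  obtain ⟨g, hg⟩ := Module.projective_lifting_property φ.rangeRestrict
    (ψ.codRestrict φ.range fun x => h x) φ.surjective_rangeRestrict
  exact ⟨g, fun x => congrArg Subtype.val (LinearMap.congr_fun hg x)⟩

/-- The map from a representation at a vertex to the product over the outgoing arrows. -/
def outMap (X : ModQ Λ Q) (i : Paths Q) : X.obj i →ₗ[Λ] ∀ j, Arr i j → X.obj j :=
  LinearMap.pi fun _ => LinearMap.pi fun α => act X (edge α)

variable [Finite Q] [IsAcyclic Q]

/-- Once the lift is fixed at the targets of the arrows out of `i`, the prescribed values lie in the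
fibre product onto which `N_i` surjects; projectivity of `M_i` makes the choice of preimages linear.
-/
lemma RelArrowSurjective.exists_lift {M N Y : ModQ Λ Q}
    (hM : ∀ i, Module.Projective Λ (M.obj i)) {p : N ⟶ Y} (hp : RelArrowSurjective p)
    (f : M ⟶ Y) : ∃ g : M ⟶ N, g ≫ p = f := by
  obtain ⟨c, hc⟩ := exists_sink_recursion
    (C := fun i : Paths Q => {g : M.obj i →ₗ[Λ] N.obj i // ∀ x, comp p i (g x) = comp f i x})
    (R := fun i g c => ∀ j (α : Arr i j) x, act N (edge α) (g.1 x) = (c j α).1 (act M (edge α) x))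
    (fun i c => by
      have := hM i
      obtain ⟨g, hg⟩ := exists_comp_eq_of_range_le
        ((comp p i).prod (outMap N i))
        ((comp f i).prod (LinearMap.pi fun j => LinearMap.pi fun α =>
          (c j α).1 ∘ₗ act M (edge α))) (fun x => by
          obtain ⟨a, ha, ha'⟩ := hp i (comp f i x) (fun j α => (c j α).1 (act M (edge α) x))
            (fun j α => by rw [(c j α).2, comp_act])
          exact ⟨a, Prod.ext ha (funext fun j => funext fun α => ha' j α)⟩)
      exact ⟨⟨g, fun x => congrArg Prod.fst (hg x)⟩, fun j α x =>
        congrFun (congrFun (congrArg Prod.snd (hg x)) j) α⟩)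
  exact ⟨mkHom (fun i => (c i).1) (fun α x => (hc _ _ α x).symm),
    hom_ext fun i x => (c i).2 x⟩

/-- Morphisms into an arrow-surjective representation extend along morphisms with vertexwise
retractions and vertexwise projective target. -/
lemma ArrowSurjective.exists_extension {A B X : ModQ Λ Q} (hX : ArrowSurjective X)
    (hB : ∀ i, Module.Projective Λ (B.obj i)) (a : A ⟶ B)
    (r : ∀ i, B.obj i →ₗ[Λ] A.obj i) (hr : ∀ i x, r i (comp a i x) = x) (f : A ⟶ X) :
    ∃ g : B ⟶ X, a ≫ g = f := by
  obtain ⟨c, hc⟩ := exists_sink_recursion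
    (C := fun i : Paths Q => {g : B.obj i →ₗ[Λ] X.obj i // ∀ x, g (comp a i x) = comp f i x})
    (R := fun i g c => ∀ j (α : Arr i j) x, act X (edge α) (g.1 x) = (c j α).1 (act B (edge α) x))
    (fun i c => by
      have := hB i
      obtain ⟨g, hg⟩ := exists_comp_eq_of_range_le (outMap X i)
        (LinearMap.pi fun j => LinearMap.pi fun α => (c j α).1 ∘ₗ act B (edge α)) (fun x => by
          obtain ⟨z, hz⟩ := hX i (fun j α => (c j α).1 (act B (edge α) x))
          exact ⟨z, funext fun j => funext fun α => hz j α⟩)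
      have hg' : ∀ j (α : Arr i j) x, act X (edge α) (g x) = (c j α).1 (act B (edge α) x) :=
        fun j α x => congrFun (congrFun (hg x) j) α
      -- `g` respects the arrows but need not extend `f`. The correction fixes this, and every
      -- outgoing arrow kills it, because `f` and `g ∘ a` agree after applying the arrow.
      refine ⟨⟨g + (comp f i - g ∘ₗ comp a i) ∘ₗ r i, fun x => ?_⟩, fun j α x => ?_⟩
      · simp [hr]
      · simp only [LinearMap.add_apply, LinearMap.comp_apply, LinearMap.sub_apply, map_add,
          map_sub, hg', ← comp_act, (c j α).2, sub_self, add_zero])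
  exact ⟨mkHom (fun i => (c i).1) (fun α x => (hc _ _ α x).symm),
    hom_ext fun i x => (c i).2 x⟩

/-- A surjection from a finitely generated projective module onto the value of `X` at `i`. -/
structure CoverAt (X : ModQ Λ Q) (i : Paths Q) where
  /-- the projective module -/
  obj : FGModuleCat.{u} Λ
  /-- the surjection -/
  map : obj →ₗ[Λ] X.obj i
  projective : Module.Projective Λ obj
  surjective : Function.Surjective map

/-- Every representation admits a relatively arrow-surjective morphism from a vertexwise
projective one. -/
lemma exists_cover [IsNoetherianRing Λ] [∀ i j : Q, Finite (i ⟶ j)] (X : ModQ Λ Q) :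
    ∃ (P : ModQ Λ Q) (p : P ⟶ X), (∀ i, Module.Projective Λ (P.obj i)) ∧
      (∀ i, Function.Surjective (comp p i)) ∧ RelArrowSurjective p := by
  obtain ⟨c, hc⟩ := exists_sink_recursion (C := CoverAt X)
    (R := fun i x c => ∃ φ : ∀ j (α : Arr i j), x.obj →ₗ[Λ] (c j α).obj,
      (∀ j α z, (c j α).map (φ j α z) = act X (edge α) (x.map z)) ∧
      ∀ (y : X.obj i) (n : ∀ j (α : Arr i j), (c j α).obj),
        (∀ j α, (c j α).map (n j α) = act X (edge α) y) →
          ∃ z, x.map z = y ∧ ∀ j α, φ j α z = n j α)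
    (fun i c => by
      -- `S` is the fibre product of `X_i` with the covers already built at the arrow targets. A
      -- finite free module mapping onto it supplies both the cover at `i` and its structure maps
      -- `φ`, as the two projections.
      let B := X.obj i × ∀ j (α : Arr i j), (c j α).obj
      let S : Submodule Λ B :=
        { carrier := {b | ∀ j α, (c j α).map (b.2 j α) = act X (edge α) b.1}
          add_mem' := fun {a b} ha hb j α => by
            refine ((c j α).map.map_add _ _).trans ?_
            rw [ha j α, hb j α]
            exact ((act X (edge α)).map_add _ _).symm
          zero_mem' := fun j α => by simp
          smul_mem' := fun r b hb j α => by
            refine ((c j α).map.map_smul r _).trans ?_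
            rw [hb j α]
            exact ((act X (edge α)).map_smul r _).symm }
      have : Module.Finite Λ S := inferInstance
      obtain ⟨n, f, hf⟩ := Module.Finite.exists_fin' Λ S
      refine ⟨⟨FGModuleCat.of Λ (Fin n → Λ), LinearMap.fst Λ _ _ ∘ₗ S.subtype ∘ₗ f,
        inferInstanceAs (Module.Projective Λ (Fin n → Λ)), fun y => ?_⟩,
        fun j α => LinearMap.proj α ∘ₗ LinearMap.proj j ∘ₗ LinearMap.snd Λ _ _ ∘ₗ S.subtype ∘ₗ f,
        fun j α z => (f z).2 j α, fun y m hm => ?_⟩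
      · choose m hm using fun j (α : Arr i j) => (c j α).surjective (act X (edge α) y)
        obtain ⟨z, hz⟩ := hf ⟨(y, m), hm⟩
        exact ⟨z, congrArg (fun s : S => s.1.1) hz⟩
      · obtain ⟨z, hz⟩ := hf ⟨(y, m), hm⟩
        exact ⟨z, congrArg (fun s : S => s.1.1) hz,
          fun j α => congrArg (fun s : S => s.1.2 j α) hz⟩)
  choose φ hφ hφ' using hc
  refine ⟨mkRep (fun i => (c i).obj) φ, mkHom (fun i => (c i).map) (fun {i j} α x => ?_),
    fun i => (c i).projective, fun i => (c i).surjective, fun i y n hn => ?_⟩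
  · exact (congrArg (c j).map (act_mkRep (fun i => (c i).obj) φ α x)).trans (hφ i j α x)
  · obtain ⟨z, hz, hz'⟩ := hφ' i y n hn
    exact ⟨z, hz, fun j α => (act_mkRep (fun i => (c i).obj) φ α z).trans (hz' j α)⟩

end Lifting

/-! ### The largest arrow-surjective subrepresentation -/

section Trace

variable {Λ : Type u} [Ring Λ] {Q : Type u} [Quiver.{u} Q]

/-- A family of additive subgroups that is stable under all paths and arrow-surjective. -/
structure IsSurjSub (X : ModQ Λ Q) (S : ∀ i, AddSubgroup (X.obj i)) : Prop where
  act_mem : ∀ {i j : Paths Q} (σ : i ⟶ j) {x}, x ∈ S i → act X σ x ∈ S j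
  exists_mem : ∀ (i : Paths Q) (y : ∀ j, Arr i j → X.obj j), (∀ j α, y j α ∈ S j) →
    ∃ x ∈ S i, ∀ j α, act X (edge α) x = y j α

namespace IsSurjSub

variable {X Y : ModQ Λ Q}

lemma bot : IsSurjSub X (fun _ => ⊥) where
  act_mem σ x hx := by
    rw [AddSubgroup.mem_bot] at hx ⊢
    rw [hx, map_zero]
  exists_mem i y hy := ⟨0, zero_mem _, fun j α => by
    rw [map_zero, AddSubgroup.mem_bot.1 (hy j α)]⟩

lemma sup {S T : ∀ i, AddSubgroup (X.obj i)} (hS : IsSurjSub X S) (hT : IsSurjSub X T) :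
    IsSurjSub X (fun i => S i ⊔ T i) where
  act_mem σ x hx := by
    obtain ⟨a, ha, b, hb, rfl⟩ := AddSubgroup.mem_sup.1 hx
    rw [map_add]
    exact AddSubgroup.add_mem_sup (hS.act_mem σ ha) (hT.act_mem σ hb)
  exists_mem i y hy := by
    choose a ha b hb h using fun j α => AddSubgroup.mem_sup.1 (hy j α)
    obtain ⟨x, hx, hx'⟩ := hS.exists_mem i a ha
    obtain ⟨z, hz, hz'⟩ := hT.exists_mem i b hb
    exact ⟨x + z, AddSubgroup.add_mem_sup hx hz, fun j α => by rw [map_add, hx', hz', h]⟩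

lemma map {S : ∀ i, AddSubgroup (X.obj i)} (hS : IsSurjSub X S)
    (f : ∀ i, X.obj i →+ Y.obj i)
    (hf : ∀ {i j : Paths Q} (σ : i ⟶ j) x, f j (act X σ x) = act Y σ (f i x)) :
    IsSurjSub Y (fun i => (S i).map (f i)) where
  act_mem σ x := by
    rintro ⟨z, hz, rfl⟩
    exact ⟨_, hS.act_mem σ hz, hf σ z⟩
  exists_mem i y hy := by
    choose z hz h using hy
    obtain ⟨x, hx, hx'⟩ := hS.exists_mem i z hz
    exact ⟨f i x, ⟨x, hx, rfl⟩, fun j α => by rw [← hf, hx', h]⟩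

end IsSurjSub

lemma ArrowSurjective.isSurjSub_top {X : ModQ Λ Q} (hX : ArrowSurjective X) :
    IsSurjSub X (fun _ => ⊤) where
  act_mem _ _ _ := AddSubgroup.mem_top _
  exists_mem i y _ := by
    obtain ⟨x, hx⟩ := hX i y
    exact ⟨x, AddSubgroup.mem_top _, hx⟩

/-- The largest arrow-surjective subrepresentation. -/
def trace (X : ModQ Λ Q) (i : Paths Q) : Submodule Λ (X.obj i) where
  carrier := {x | ∃ S, IsSurjSub X S ∧ x ∈ S i}
  add_mem' := fun ⟨_, hS, ha⟩ ⟨_, hT, hb⟩ =>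
    ⟨_, hS.sup hT, AddSubgroup.add_mem_sup ha hb⟩
  zero_mem' := ⟨_, IsSurjSub.bot, zero_mem _⟩
  smul_mem' := fun r x ⟨_, hS, hx⟩ =>
    -- Scalar multiplication by `r` is additive and commutes with all paths, so it carries one
    -- family to another even when `Λ` is noncommutative.
    ⟨_, hS.map (fun i => DistribSMul.toAddMonoidHom (X.obj i) r)
      (fun σ x => ((act X σ).map_smul r x).symm), ⟨x, hx, rfl⟩⟩

lemma comp_mem_trace {X Y : ModQ Λ Q} (f : X ⟶ Y) {i : Paths Q} {x : X.obj i}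
    (hx : x ∈ trace X i) : comp f i x ∈ trace Y i := by
  obtain ⟨S, hS, hx⟩ := hx
  exact ⟨_, hS.map (fun i => (comp f i).toAddMonoidHom) (fun σ x => comp_act f σ x), ⟨x, hx, rfl⟩⟩

lemma ArrowSurjective.mem_trace {X : ModQ Λ Q} (hX : ArrowSurjective X) {i : Paths Q}
    (x : X.obj i) : x ∈ trace X i := ⟨_, hX.isSurjSub_top, AddSubgroup.mem_top _⟩

lemma act_mem_trace {X : ModQ Λ Q} {i j : Paths Q} (σ : i ⟶ j) {x : X.obj i}
    (hx : x ∈ trace X i) : act X σ x ∈ trace X j := by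
  obtain ⟨S, hS, hx⟩ := hx
  exact ⟨S, hS, hS.act_mem σ hx⟩

/-- The entries `y j α` may come from different families; as there are only finitely many arrows,
one common family contains them all. -/
lemma exists_mem_trace [Finite Q] [∀ i j : Q, Finite (i ⟶ j)] (X : ModQ Λ Q) (i : Paths Q)
    (y : ∀ j, Arr i j → X.obj j) (hy : ∀ j α, y j α ∈ trace X j) :
    ∃ x ∈ trace X i, ∀ j α, act X (edge α) x = y j α := by
  choose S hS h using hy
  let T : (Σ j, Arr i j) → {S : ∀ i, AddSubgroup (X.obj i) // IsSurjSub X S} :=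
    fun a => ⟨S a.1 a.2, hS a.1 a.2⟩
  have hdir : Directed (· ≤ ·) (id : {S : ∀ i, AddSubgroup (X.obj i) // IsSurjSub X S} → _) :=
    fun S T => ⟨⟨_, S.2.sup T.2⟩, fun _ => le_sup_left, fun _ => le_sup_right⟩
  have : Nonempty {S : ∀ i, AddSubgroup (X.obj i) // IsSurjSub X S} := ⟨⟨_, IsSurjSub.bot⟩⟩
  obtain ⟨U, hU⟩ := hdir.finite_le T
  obtain ⟨x, hx, hx'⟩ := U.2.exists_mem i y (fun j α => hU ⟨j, α⟩ j (h j α))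
  exact ⟨x, ⟨U.1, U.2, hx⟩, hx'⟩

/-- The largest arrow-surjective subrepresentation, as a representation. -/
def traceRep [IsNoetherianRing Λ] (X : ModQ Λ Q) : ModQ Λ Q where
  obj i := FGModuleCat.of Λ (trace X i)
  map σ := FGModuleCat.ofHom ((act X σ).restrict fun _ hx => act_mem_trace σ hx)
  map_id i := FGModuleCat.hom_ext (LinearMap.ext fun x => Subtype.ext (act_id X i x.1))
  map_comp σ τ := FGModuleCat.hom_ext (LinearMap.ext fun x => Subtype.ext (act_comp X σ τ x.1))

/-- The inclusion of the largest arrow-surjective subrepresentation. -/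
def traceι [IsNoetherianRing Λ] (X : ModQ Λ Q) : traceRep X ⟶ X where
  app i := ConcreteCategory.ofHom (trace X i).subtype
  naturality _ _ _ := rfl

lemma arrowSurjective_traceRep [IsNoetherianRing Λ] [Finite Q] [∀ i j : Q, Finite (i ⟶ j)]
    (X : ModQ Λ Q) : ArrowSurjective (traceRep X) := fun i y => by
  obtain ⟨x, hx, h⟩ := exists_mem_trace X i (fun j α => (y j α).1) (fun j α => (y j α).2)
  exact ⟨⟨x, hx⟩, fun j α => Subtype.ext (h j α)⟩

/-- The quotient of a representation by its largest arrow-surjective subrepresentation. -/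
def traceQuot (X : ModQ Λ Q) : ModQ Λ Q where
  obj i := FGModuleCat.of Λ (X.obj i ⧸ trace X i)
  map {i j} σ := FGModuleCat.ofHom
    ((trace X i).mapQ (trace X j) (act X σ) fun _ hx => act_mem_trace σ hx)
  map_id i := FGModuleCat.hom_ext (LinearMap.ext fun x => by
    obtain ⟨x, rfl⟩ := Submodule.Quotient.mk_surjective _ x
    exact congrArg Submodule.Quotient.mk (act_id X i x))
  map_comp σ τ := FGModuleCat.hom_ext (LinearMap.ext fun x => by
    obtain ⟨x, rfl⟩ := Submodule.Quotient.mk_surjective _ x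
    exact congrArg Submodule.Quotient.mk (act_comp X σ τ x))

/-- The projection onto the quotient by the largest arrow-surjective subrepresentation. -/
def traceπ (X : ModQ Λ Q) : X ⟶ traceQuot X where
  app i := ConcreteCategory.ofHom (trace X i).mkQ
  naturality _ _ _ := rfl

lemma comp_traceπ_surjective (X : ModQ Λ Q) (i : Paths Q) :
    Function.Surjective (comp (traceπ X) i) := (trace X i).mkQ_surjective

lemma comp_traceπ_eq_zero_iff {X : ModQ Λ Q} {i : Paths Q} {x : X.obj i} :
    comp (traceπ X) i x = 0 ↔ x ∈ trace X i := Submodule.Quotient.mk_eq_zero _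

lemma traceπ_epi {X Y : ModQ Λ Q} {f g : traceQuot X ⟶ Y} (h : traceπ X ≫ f = traceπ X ≫ g) :
    f = g := hom_ext fun i x => by
  obtain ⟨x, rfl⟩ := comp_traceπ_surjective X i x
  rw [← comp_comp, ← comp_comp, h]

/-- The morphism from the quotient induced by one vanishing on the largest arrow-surjective
subrepresentation. -/
def traceDesc {X Y : ModQ Λ Q} (f : X ⟶ Y) (hf : ∀ i, ∀ x ∈ trace X i, comp f i x = 0) :
    traceQuot X ⟶ Y :=
  mkHom (fun i => (trace X i).liftQ (comp f i) (hf i)) fun {i j} α x => by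
    obtain ⟨x, rfl⟩ := Submodule.Quotient.mk_surjective _ x
    exact comp_act f (edge α) x

/-- Any preimage of `y` can be corrected by an element of the kernel, so it is enough that `p` is
onto with arrow-surjective kernel. -/
lemma relArrowSurjective_of_exists {N Y : ModQ Λ Q} (p : N ⟶ Y)
    (hp : ∀ i, Function.Surjective (comp p i))
    (hker : ∀ i (y : ∀ j, Arr i j → N.obj j), (∀ j α, comp p j (y j α) = 0) →
      ∃ x, comp p i x = 0 ∧ ∀ j α, act N (edge α) x = y j α) : RelArrowSurjective p := by
  intro i y n h
  obtain ⟨x, rfl⟩ := hp i y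
  obtain ⟨z, hz, hz'⟩ := hker i (fun j α => n j α - act N (edge α) x) (fun j α => by
    rw [map_sub, h, comp_act, sub_self])
  exact ⟨x + z, by rw [map_add, hz, add_zero], fun j α => by
    rw [map_add, hz', add_sub_cancel]⟩

/-- The preimage of an arrow-surjective family under a relatively arrow-surjective morphism. -/
lemma RelArrowSurjective.isSurjSub_comap {N Y : ModQ Λ Q} {p : N ⟶ Y}
    (hp : RelArrowSurjective p) {S : ∀ i, AddSubgroup (Y.obj i)} (hS : IsSurjSub Y S) :
    IsSurjSub N (fun i => (S i).comap (comp p i).toAddMonoidHom) where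
  act_mem {i j} σ x hx := by
    have := hS.act_mem σ hx
    refine (?_ : comp p j (act N σ x) ∈ S j)
    rw [comp_act]
    exact this
  exists_mem i n hn := by
    obtain ⟨y, hy, h⟩ := hS.exists_mem i (fun j α => comp p j (n j α)) hn
    obtain ⟨x, hx, hx'⟩ := hp i y n (fun j α => (h j α).symm)
    refine ⟨x, (?_ : comp p i x ∈ S i), hx'⟩
    rw [hx]
    exact hy

lemma RelArrowSurjective.mem_trace_iff {N Y : ModQ Λ Q} {p : N ⟶ Y}
    (hp : RelArrowSurjective p) {i : Paths Q} {x : N.obj i} :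
    x ∈ trace N i ↔ comp p i x ∈ trace Y i :=
  ⟨comp_mem_trace p, fun ⟨_, hS, hx⟩ => ⟨_, hp.isSurjSub_comap hS, hx⟩⟩

section

variable [Finite Q] [∀ i j : Q, Finite (i ⟶ j)]

lemma relArrowSurjective_traceπ (X : ModQ Λ Q) : RelArrowSurjective (traceπ X) :=
  relArrowSurjective_of_exists _ (comp_traceπ_surjective X) fun i y hy => by
    obtain ⟨x, hx, h⟩ := exists_mem_trace X i y fun j α => comp_traceπ_eq_zero_iff.1 (hy j α)
    exact ⟨x, comp_traceπ_eq_zero_iff.2 hx, h⟩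

lemma trace_traceQuot (X : ModQ Λ Q) {i : Paths Q} {x : (traceQuot X).obj i}
    (hx : x ∈ trace (traceQuot X) i) : x = 0 := by
  obtain ⟨x, rfl⟩ := comp_traceπ_surjective X i x
  rw [← (relArrowSurjective_traceπ X).mem_trace_iff] at hx
  exact comp_traceπ_eq_zero_iff.2 hx

end

end Trace

/-! ### Coinduced representations -/

section Coinduced

section Paths

variable {Q : Type u} [Quiver.{u} Q]

/-- A path of positive length determines its first arrow and the rest. Paths grow at their end, so
the induction strips last arrows. -/
lemma toPath_comp_injective {i j j' m : Q} (α : i ⟶ j) (ρ : Quiver.Path j m) (α' : i ⟶ j')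
    (ρ' : Quiver.Path j' m) (h : α.toPath.comp ρ = α'.toPath.comp ρ') :
    (⟨j, α, ρ⟩ : Σ l : Q, (i ⟶ l) × Quiver.Path l m) = ⟨j', α', ρ'⟩ := by
  induction ρ with
  | nil =>
    cases ρ' with
    | nil =>
      have := Quiver.Path.heq_of_cons_eq_cons h
      have h' := Quiver.Path.hom_heq_of_cons_eq_cons h
      cases h'
      rfl
    | cons ρ' e =>
      have := congrArg Quiver.Path.length h
      simp [Quiver.Path.length_comp, Quiver.Hom.toPath] at this
  | cons ρ e ih =>
    cases ρ' with
    | nil =>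
      have := congrArg Quiver.Path.length h
      simp [Quiver.Path.length_comp, Quiver.Hom.toPath] at this
    | cons ρ' e' =>
      rw [Quiver.Path.comp_cons, Quiver.Path.comp_cons] at h
      obtain rfl := Quiver.Path.obj_eq_of_cons_eq_cons h
      obtain rfl := eq_of_heq (Quiver.Path.hom_heq_of_cons_eq_cons h)
      have := ih ρ' (eq_of_heq (Quiver.Path.heq_of_cons_eq_cons h))
      cases this
      rfl

lemma exists_function_on_paths {A : Type*} [Zero A] {i m : Paths Q}
    (y : ∀ j, Arr i j → (j ⟶ m) → A) :
    ∃ x : (i ⟶ m) → A, ∀ j α (ρ : j ⟶ m), x (edge α ≫ ρ) = y j α ρ := by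
  let f : (Σ j : Paths Q, Arr i j × (j ⟶ m)) → (i ⟶ m) := fun a => edge a.2.1 ≫ a.2.2
  have hf : Function.Injective f := fun a b h =>
    toPath_comp_injective (Q := Q) a.2.1 a.2.2 b.2.1 b.2.2 h
  -- The value `0` is only used at paths that do not begin with an arrow, that is, at the trivial
  -- path when `i = m`.
  exact ⟨Function.extend f (fun a => y a.1 a.2.1 a.2.2) 0,
    fun j α ρ => hf.extend_apply _ _ ⟨j, α, ρ⟩⟩

instance [Finite Q] [∀ i j : Q, Finite (i ⟶ j)] [IsAcyclic Q] (i j : Paths Q) :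
    Finite (i ⟶ j) := finite_path Q i j

end Paths

variable {Λ : Type u} [Ring Λ] {Q : Type u} [Quiver.{u} Q]

lemma ArrowSurjective.of_retract {X Y : ModQ Λ Q} (hY : ArrowSurjective Y) (r : Retract X Y) :
    ArrowSurjective X := fun i y => by
  obtain ⟨x, hx⟩ := hY i (fun j α => comp r.i j (y j α))
  refine ⟨comp r.r i x, fun j α => ?_⟩
  rw [← comp_act, hx, ← comp_comp, r.retract, comp_id]

variable [Finite Q] [∀ i j : Q, Finite (i ⟶ j)] [IsAcyclic Q]

lemma arrowSurjective_coind (i : Q) (A : FGModuleCat.{u} Λ) : ArrowSurjective (coind i A) :=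
  fun l y => by
    obtain ⟨x, hx⟩ := exists_function_on_paths (Q := Q) (A := A) (i := l) (m := i) y
    exact ⟨x, fun j α => funext fun ρ => hx j α ρ⟩

/-- The product of all `coind j (A j)`. -/
def coindProd (A : Paths Q → FGModuleCat.{u} Λ) : ModQ Λ Q where
  obj l := FGModuleCat.of Λ (∀ j, (l ⟶ j) → A j)
  map {l _} σ := FGModuleCat.ofHom
    (LinearMap.pi fun j => LinearMap.pi fun ρ =>
      (LinearMap.proj (σ ≫ ρ) : ((l ⟶ j) → A j) →ₗ[Λ] A j) ∘ₗ
        (LinearMap.proj j : (∀ j, (l ⟶ j) → A j) →ₗ[Λ] (l ⟶ j) → A j))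
  map_id _ := FGModuleCat.hom_ext (LinearMap.ext fun x => funext fun j => funext fun ρ =>
    congrArg (x j) (Category.id_comp ρ))
  map_comp σ τ := FGModuleCat.hom_ext (LinearMap.ext fun x => funext fun j => funext fun ρ =>
    congrArg (x j) (Category.assoc σ τ ρ))

lemma arrowSurjective_coindProd (A : Paths Q → FGModuleCat.{u} Λ) :
    ArrowSurjective (coindProd A) := fun l y => by
  choose x hx using fun m => exists_function_on_paths (Q := Q) (A := A m) (i := l) (m := m)
    (fun j α => y j α m)
  exact ⟨x, fun j α => funext fun m => funext fun ρ => hx m j α ρ⟩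

/-- The unit of coinduction. -/
def toCoindProd (X : ModQ Λ Q) : X ⟶ coindProd X.obj :=
  mkHom (fun _ => LinearMap.pi fun _ => LinearMap.pi fun ρ => act X ρ) fun α x =>
    funext fun _ => funext fun ρ => (act_comp X (edge α) ρ x).symm

/-- The vertexwise retraction of the unit of coinduction, at the trivial paths. -/
def coindProdRetraction (X : ModQ Λ Q) (i : Paths Q) : (coindProd X.obj).obj i →ₗ[Λ] X.obj i :=
  LinearMap.proj (𝟙 i) ∘ₗ (LinearMap.proj i : (∀ j, (i ⟶ j) → X.obj j) →ₗ[Λ] _)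

lemma coindProdRetraction_toCoindProd (X : ModQ Λ Q) (i : Paths Q) (x : X.obj i) :
    coindProdRetraction X i (comp (toCoindProd X) i x) = x := act_id X i x

lemma projective_pi {ι : Type*} [Finite ι] (A : ι → Type*) [∀ i, AddCommGroup (A i)]
    [∀ i, Module Λ (A i)] [∀ i, Module.Projective Λ (A i)] :
    Module.Projective Λ (∀ i, A i) := by
  classical
  have := Fintype.ofFinite ι
  exact Module.Projective.of_equiv (DFinsupp.linearEquivFunOnFintype (R := Λ) (M := A))

/-- The unit into `coindProd` has vertexwise retractions, so the identity of `X` extends along it.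
-/
lemma ArrowSurjective.nonempty_retract {X : ModQ Λ Q} (hX : ArrowSurjective X)
    (hP : ∀ i, Module.Projective Λ (X.obj i)) : Nonempty (Retract X (coindProd X.obj)) := by
  obtain ⟨g, hg⟩ := hX.exists_extension (B := coindProd X.obj)
    (fun i => by
      have := fun j => projective_pi (Λ := Λ) (fun _ : i ⟶ j => X.obj j)
      exact projective_pi (Λ := Λ) (fun j : Paths Q => (i ⟶ j) → X.obj j))
    (toCoindProd X) (coindProdRetraction X) (coindProdRetraction_toCoindProd X) (𝟙 X)
  exact ⟨⟨toCoindProd X, g, hg⟩⟩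

open Classical in
/-- The bicone exhibiting `coindProd A` as the biproduct of the `coind j (A j)`. -/
def coindBicone {n : ℕ} (e : Fin n ≃ Paths Q) (A : Paths Q → FGModuleCat.{u} Λ) :
    Bicone (fun a : Fin n => coind (Q := Q) (e a) (A (e a))) where
  pt := coindProd A
  π a := mkHom (fun l => (LinearMap.proj (e a) : (∀ j, (l ⟶ j) → A j) →ₗ[Λ] _))
    fun α x => rfl
  ι a := mkHom (fun l => LinearMap.single Λ (fun j => (l ⟶ j) → A j) (e a)) fun {l m} α x => by
    refine funext fun j => ?_
    by_cases h : j = e a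
    · subst h
      refine (Pi.single_eq_same (M := fun j => (m ⟶ j) → A j) (e a) _).trans
        (funext fun ρ => ?_)
      exact (congrFun (Pi.single_eq_same (M := fun j => (l ⟶ j) → A j) (e a) x) _).symm
    · refine (Pi.single_eq_of_ne h _).trans (funext fun ρ => ?_)
      exact (congrFun (Pi.single_eq_of_ne (M := fun j => (l ⟶ j) → A j) h x) _).symm
  ι_π a b := by
    refine hom_ext fun l x => ?_
    by_cases h : a = b
    · subst h
      rw [dif_pos rfl]
      exact Pi.single_eq_same (M := fun j => (l ⟶ j) → A j) (e a) x
    · rw [dif_neg h]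
      exact Pi.single_eq_of_ne (M := fun j => (l ⟶ j) → A j)
        (fun h' => h (e.injective h'.symm)) x

lemma coindBicone_isBilimit {n : ℕ} (e : Fin n ≃ Paths Q) (A : Paths Q → FGModuleCat.{u} Λ) :
    Nonempty (coindBicone e A).IsBilimit := by
  classical
  refine ⟨isBilimitOfTotal _ (hom_ext fun l x => ?_)⟩
  rw [comp_sum, comp_id]
  have : ∀ y : ∀ j, (l ⟶ j) → A j, ∑ a, Pi.single (e a) (y (e a)) = y := fun y => by
    have := Fintype.ofFinite (Paths Q)
    rw [e.sum_comp (fun j => Pi.single j (y j)), Finset.univ_sum_single]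
  refine Eq.trans ?_ (this x)
  refine Finset.sum_congr rfl fun a _ => ?_
  refine funext fun j => ?_
  by_cases h : j = e a
  · subst h
    exact (Pi.single_eq_same (M := fun j => (l ⟶ j) → A j) _ _).trans
      (Pi.single_eq_same (M := fun j => (l ⟶ j) → A j) _ _).symm
  · exact (Pi.single_eq_of_ne (M := fun j => (l ⟶ j) → A j) h _).trans
      (Pi.single_eq_of_ne (M := fun j => (l ⟶ j) → A j) h _).symm

lemma tilt_of_arrowSurjective {X : ModQ Λ Q} (hX : ArrowSurjective X)
    (hP : ∀ i, Module.Projective Λ (X.obj i)) : tilt Λ Q X := by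
  obtain ⟨n, ⟨e⟩⟩ := Finite.exists_equiv_fin (Paths Q)
  exact ⟨n, _, coindBicone e.symm X.obj, fun a => ⟨_, _, hP _, rfl⟩,
    coindBicone_isBilimit e.symm X.obj, hX.nonempty_retract hP⟩

/-- Coinduced representations are arrow-surjective, and the property passes to finite direct sums
and retracts. -/
lemma arrowSurjective_of_tilt {X : ModQ Λ Q} (hX : tilt Λ Q X) : ArrowSurjective X := by
  obtain ⟨n, F, b, hF, ⟨hb⟩, ⟨r⟩⟩ := hX
  refine ArrowSurjective.of_retract (fun i y => ?_) r
  have h : ∀ a, ArrowSurjective (F a) := fun a => by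
    obtain ⟨i, P, _, h⟩ := hF a
    rw [h]
    exact arrowSurjective_coind i P
  choose x hx using fun a => h a i (fun j α => comp (b.π a) j (y j α))
  refine ⟨∑ a, comp (b.ι a) i (x a), fun j α => ?_⟩
  rw [map_sum]
  conv_rhs => rw [← comp_id j (y j α), ← IsBilimit.total hb, comp_sum]
  exact Finset.sum_congr rfl fun a _ => by rw [← comp_act, hx, comp_comp]

end Coinduced

/-! ### Injective representations over a field -/

section Field

variable {k : Type u} [Field k] {Q : Type u} [Quiver.{u} Q]

lemma mono_of_injective {Λ : Type u} [Ring Λ] {X Y : ModQ Λ Q} (f : X ⟶ Y)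
    (hf : ∀ i, Function.Injective (comp f i)) : Mono f where
  right_cancellation g h e := hom_ext fun i x => hf i (by
    rw [← comp_comp, ← comp_comp, e])

/-- The vertexwise kernels form a subrepresentation, finitely generated since `Λ` is Noetherian; its
inclusion is killed by `f`, hence zero. -/
lemma injective_of_mono {Λ : Type u} [Ring Λ] [IsNoetherianRing Λ] {X Y : ModQ Λ Q} (f : X ⟶ Y)
    [Mono f] (i : Paths Q) : Function.Injective (comp f i) := by
  have hK : ∀ {i j : Paths Q} (σ : i ⟶ j), ∀ x ∈ LinearMap.ker (comp f i),
      act X σ x ∈ LinearMap.ker (comp f j) := fun σ x hx => by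
    rw [LinearMap.mem_ker] at hx ⊢
    rw [comp_act, hx, map_zero]
  let K : ModQ Λ Q :=
    { obj := fun i => FGModuleCat.of Λ (LinearMap.ker (comp f i))
      map := fun σ => FGModuleCat.ofHom ((act X σ).restrict (hK σ))
      map_id := fun i => FGModuleCat.hom_ext (LinearMap.ext fun x =>
        Subtype.ext (act_id X i x.1))
      map_comp := fun σ τ => FGModuleCat.hom_ext (LinearMap.ext fun x =>
        Subtype.ext (act_comp X σ τ x.1)) }
  let ι : K ⟶ X :=
    { app := fun i => ConcreteCategory.ofHom (LinearMap.ker (comp f i)).subtype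
      naturality := fun _ _ _ => rfl }
  have hι : ι = 0 := (cancel_mono f).1 (hom_ext fun i x => by
    have h : comp f i x.1 = 0 := x.2
    exact h.trans (map_zero (comp f i)).symm)
  rw [← LinearMap.ker_eq_bot, LinearMap.ker_eq_bot']
  intro x hx
  exact congrArg (fun g : K ⟶ X => comp g i ⟨x, hx⟩) hι

variable [Finite Q] [IsAcyclic Q]

/-- Over a field every vertex space is projective and every vertexwise injection has a linear
retraction, so the extension lemma applies to all monomorphisms. -/
lemma ArrowSurjective.injective {X : ModQ k Q} (hX : ArrowSurjective X) : Injective X where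
  factors {A B} f a _ := by
    choose r hr using fun i => LinearMap.exists_leftInverse_of_injective (comp a i)
      (LinearMap.ker_eq_bot.2 (injective_of_mono a i))
    exact hX.exists_extension (fun i => inferInstance) a r
      (fun i x => LinearMap.congr_fun (hr i) x) f

variable [∀ i j : Q, Finite (i ⟶ j)]

lemma arrowSurjective_of_injective (X : ModQ k Q) [Injective X] : ArrowSurjective X := by
  have : Mono (toCoindProd X) := mono_of_injective _ fun i =>
    Function.LeftInverse.injective (coindProdRetraction_toCoindProd X i)
  exact (arrowSurjective_coindProd X.obj).of_retract
    ⟨toCoindProd X, Injective.factorThru (𝟙 X) (toCoindProd X), Injective.comp_factorThru _ _⟩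

lemma noInjUnderlying_iff {Λ : Type u} [Ring Λ] [Algebra k Λ] [Module.Finite k Λ]
    [IsNoetherianRing Λ] {X : ModQ Λ Q} :
    noInjUnderlying k Λ Q X ↔ ∀ i, ∀ x ∈ trace X i, x = 0 := by
  constructor
  · intro h i x hx
    -- Restricted to `k`, the trace is arrow-surjective, hence injective, hence a direct summand.
    let I := (restrictQ k Λ Q).obj (traceRep X)
    have hI : ArrowSurjective I := arrowSurjective_traceRep X
    have := hI.injective
    let ι : I ⟶ (restrictQ k Λ Q).obj X := (restrictQ k Λ Q).map (traceι X)
    have : Mono ι := mono_of_injective _ fun i => Subtype.val_injective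
    have h0 := h I hI.injective
      ⟨⟨ι, Injective.factorThru (𝟙 I) ι, Injective.comp_factorThru _ _⟩⟩
    have := (IsZero.iff_id_eq_zero I).1 h0
    exact congrArg Subtype.val (congrArg (fun g : I ⟶ I => comp g i ⟨x, hx⟩) this)
  · rintro h I hI ⟨r⟩
    have hS := (arrowSurjective_of_injective I).isSurjSub_top.map
      (fun i => (comp r.i i).toAddMonoidHom) (fun σ x => comp_act r.i σ x)
    -- The image of `I` is a family of `k`-subspaces, perhaps not `Λ`-stable; families of additive
    -- subgroups are allowed, so it still lies in the trace over `Λ`.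
    have hS' : IsSurjSub X _ := ⟨hS.act_mem, hS.exists_mem⟩
    rw [IsZero.iff_id_eq_zero]
    refine hom_ext fun i x => ?_
    have h0 : comp r.i i x = 0 := h i _ ⟨_, hS', ⟨x, AddSubgroup.mem_top x, rfl⟩⟩
    rw [← r.retract, comp_comp, h0, map_zero, comp_zero]

end Field

/-! ### The functor to the representations without injective summands -/

section Functor

variable {Λ : Type u} [Ring Λ] {Q : Type u} [Quiver.{u} Q]

/-- The morphism induced on the quotients by the largest arrow-surjective subrepresentations. -/
def traceMap {X Y : ModQ Λ Q} (f : X ⟶ Y) : traceQuot X ⟶ traceQuot Y :=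
  traceDesc (f ≫ traceπ Y) fun _ _ hx => comp_traceπ_eq_zero_iff.2 (comp_mem_trace f hx)

lemma traceπ_traceMap {X Y : ModQ Λ Q} (f : X ⟶ Y) :
    traceπ X ≫ traceMap f = f ≫ traceπ Y := rfl

lemma traceMap_eq_zero_iff {X Y : ModQ Λ Q} {f : X ⟶ Y} :
    traceMap f = 0 ↔ ∀ i x, comp f i x ∈ trace Y i := by
  constructor
  · intro h i x
    rw [← comp_traceπ_eq_zero_iff, ← comp_comp, ← traceπ_traceMap, h, Limits.comp_zero,
      comp_zero]
  · intro h
    refine traceπ_epi (hom_ext fun i x => ?_)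
    rw [traceπ_traceMap, Limits.comp_zero, comp_zero, comp_comp]
    exact comp_traceπ_eq_zero_iff.2 (h i x)

lemma traceMap_add {X Y : ModQ Λ Q} (f g : X ⟶ Y) :
    traceMap (f + g) = traceMap f + traceMap g := traceπ_epi rfl

lemma traceMap_sub {X Y : ModQ Λ Q} (f g : X ⟶ Y) :
    traceMap (f - g) = traceMap f - traceMap g := traceπ_epi rfl

lemma traceMap_smul {k : Type u} [Field k] [Algebra k Λ] {X Y : ModQ Λ Q} (c : k) (f : X ⟶ Y) :
    traceMap (c • f) = c • traceMap f := traceπ_epi rfl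

/-- The functor dividing out the largest arrow-surjective subrepresentation. -/
def traceQuotFunctor (Λ : Type u) [Ring Λ] (Q : Type u) [Quiver.{u} Q] :
    ModQ Λ Q ⥤ ModQ Λ Q where
  obj := traceQuot
  map := traceMap
  map_id _ := traceπ_epi rfl
  map_comp _ _ := traceπ_epi rfl

variable [Finite Q]

lemma projUnderlying_iff {X : ModQ Λ Q} :
    projUnderlying Λ Q X ↔ ∀ i, Module.Projective Λ (X.obj i) := by
  classical
  constructor
  · intro (h : Module.Projective Λ (∀ i, X.obj i)) i
    exact Module.Projective.of_split (LinearMap.single Λ (fun i => X.obj i) i)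
      (LinearMap.proj i) (LinearMap.ext fun x =>
        Pi.single_eq_same (M := fun i => X.obj i) i x)
  · intro h
    exact projective_pi (Λ := Λ) (fun i => X.obj i)

variable [∀ i j : Q, Finite (i ⟶ j)] [IsAcyclic Q]

/-- A morphism from a vertexwise projective representation dies in the quotient by the largest
arrow-surjective subrepresentations if and only if it factors through an object of `𝕋`. -/
lemma factors_tilt_iff [IsNoetherianRing Λ] {X Y : ModQ Λ Q} (hX : projUnderlying Λ Q X)
    (f : X ⟶ Y) :
    (∀ i x, comp f i x ∈ trace Y i) ↔
      ∃ (Z : ModQ Λ Q) (_ : projUnderlying Λ Q Z) (_ : tilt Λ Q Z) (a : X ⟶ Z) (b : Z ⟶ Y),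
        f = a ≫ b := by
  constructor
  · intro h
    obtain ⟨Z, p, hZ, -, hp⟩ := exists_cover (traceRep Y)
    -- A relatively arrow-surjective map onto an arrow-surjective target has an arrow-surjective
    -- source: first solve in the target, then lift.
    have hZ' : ArrowSurjective Z := fun i n => by
      obtain ⟨y, hy⟩ := arrowSurjective_traceRep Y i (fun j α => comp p j (n j α))
      obtain ⟨x, -, hx⟩ := hp i y n (fun j α => (hy j α).symm)
      exact ⟨x, hx⟩
    let g : X ⟶ traceRep Y := mkHom (fun i => (comp f i).codRestrict (trace Y i) (h i))
      fun α x => Subtype.ext (comp_act f (edge α) x)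
    obtain ⟨a, ha⟩ := hp.exists_lift (projUnderlying_iff.1 hX) g
    refine ⟨Z, projUnderlying_iff.2 hZ, tilt_of_arrowSurjective hZ' hZ, a, p ≫ traceι Y, ?_⟩
    rw [← Category.assoc, ha]
    rfl
  · rintro ⟨Z, _, hZ, a, b, rfl⟩ i x
    exact comp_mem_trace b ((arrowSurjective_of_tilt hZ).mem_trace _)

variable (k : Type u) [Field k] [Algebra k Λ] [Module.Finite k Λ]

variable (Λ Q) in
/-- Dividing out the largest arrow-surjective subrepresentation, as a functor from the vertexwise
projective representations to those without injective summands over `k`. -/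
def stableFunctor [IsNoetherianRing Λ] :
    (projUnderlying Λ Q).FullSubcategory ⥤ (noInjUnderlying k Λ Q).FullSubcategory :=
  ObjectProperty.lift _ ((projUnderlying Λ Q).ι ⋙ traceQuotFunctor Λ Q) fun X =>
    noInjUnderlying_iff.2 fun _ _ hx => trace_traceQuot X.obj hx

variable [IsNoetherianRing Λ]

instance : (stableFunctor Λ Q k).Additive where
  map_add {_ _ f g} := by
    apply ObjectProperty.hom_ext
    exact traceMap_add f.hom g.hom

instance : (stableFunctor Λ Q k).Linear k where
  map_smul f c := by
    apply ObjectProperty.hom_ext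
    exact traceMap_smul c f.hom

instance : (stableFunctor Λ Q k).Full where
  map_surjective {X Y} h := by
    obtain ⟨g, hg⟩ := (relArrowSurjective_traceπ Y.obj).exists_lift
      (projUnderlying_iff.1 X.property) (traceπ X.obj ≫ h.hom)
    refine ⟨ObjectProperty.homMk g, ?_⟩
    apply ObjectProperty.hom_ext
    exact traceπ_epi hg

instance : (stableFunctor Λ Q k).EssSurj where
  mem_essImage Y := by
    obtain ⟨P, p, hP, hsurj, hp⟩ := exists_cover Y.obj
    have hY := noInjUnderlying_iff.1 Y.property
    -- The trace of `P` is the preimage of the trace of `Y`, which is zero, so it is the kernel of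
    -- `p`.
    have hker : ∀ {i : Paths Q} {x : P.obj i}, x ∈ trace P i ↔ comp p i x = 0 := fun {i x} => by
      rw [hp.mem_trace_iff]
      exact ⟨hY i _, fun h => h ▸ zero_mem _⟩
    let q : traceQuot P ⟶ Y.obj := traceDesc p fun _ _ hx => hker.1 hx
    have : IsIso q := isIso_of_bijective q fun i => by
      refine ⟨(injective_iff_map_eq_zero _).2 fun x hx => ?_, fun y => ?_⟩
      · obtain ⟨x, rfl⟩ := comp_traceπ_surjective P i x
        exact comp_traceπ_eq_zero_iff.2 (hker.2 hx)
      · obtain ⟨x, rfl⟩ := hsurj i y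
        exact ⟨comp (traceπ P) i x, rfl⟩
    exact ⟨⟨P, projUnderlying_iff.2 hP⟩, ⟨ObjectProperty.isoMk _ (@asIso _ _ _ _ q this)⟩⟩

lemma stableFunctor_map_eq_iff {X Y : (projUnderlying Λ Q).FullSubcategory} (f g : X ⟶ Y) :
    (stableFunctor Λ Q k).map f = (stableFunctor Λ Q k).map g ↔
      factorRel ((tilt Λ Q).inverseImage (projUnderlying Λ Q).ι) f g := by
  have h1 : (stableFunctor Λ Q k).map f = (stableFunctor Λ Q k).map g ↔
      traceMap (f.hom - g.hom) = 0 := by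
    rw [traceMap_sub, sub_eq_zero]
    exact ⟨congrArg fun h : (stableFunctor Λ Q k).obj X ⟶ (stableFunctor Λ Q k).obj Y => h.hom,
      fun h => ObjectProperty.hom_ext _ h⟩
  rw [h1, traceMap_eq_zero_iff, factors_tilt_iff X.property]
  constructor
  · rintro ⟨Z, hZ, hZ', a, b, h⟩
    exact ⟨⟨Z, hZ⟩, hZ', ObjectProperty.homMk a, ObjectProperty.homMk b,
      ObjectProperty.hom_ext _ h⟩
  · rintro ⟨Z, hZ', a, b, h⟩
    exact ⟨Z.obj, Z.property, hZ', a.hom, b.hom, congrArg (fun h => h.hom) h⟩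

variable (Λ Q) in
/-- The functor induced by `stableFunctor` on the additive quotient. -/
def quotientFunctor : ProjModTilt Λ Q ⥤ (noInjUnderlying k Λ Q).FullSubcategory :=
  CategoryTheory.Quotient.lift _ (stableFunctor Λ Q k) fun _ _ f g h =>
    (stableFunctor_map_eq_iff k f g).2 h

instance : (quotientFunctor Λ Q k).Full where
  map_surjective h := by
    obtain ⟨g, hg⟩ := (stableFunctor Λ Q k).map_surjective h
    exact ⟨(toProjModTilt Λ Q).map g, hg⟩

instance : (quotientFunctor Λ Q k).Faithful where
  map_injective {_ _ f g} h := by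
    obtain ⟨f, rfl⟩ := (toProjModTilt Λ Q).map_surjective f
    obtain ⟨g, rfl⟩ := (toProjModTilt Λ Q).map_surjective g
    exact CategoryTheory.Quotient.sound _ ((stableFunctor_map_eq_iff k f g).1 h)

instance : (quotientFunctor Λ Q k).EssSurj where
  mem_essImage Y := by
    obtain ⟨X, ⟨e⟩⟩ := Functor.EssSurj.mem_essImage (F := stableFunctor Λ Q k) Y
    exact ⟨(toProjModTilt Λ Q).obj X, ⟨e⟩⟩

instance : (quotientFunctor Λ Q k).IsEquivalence where

end Functor

end QuiverRep

end

theorem mainTheorem10 (k : Type u) [Field k] (Λ : Type u) [Ring Λ] [Algebra k Λ]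
    [Module.Finite k Λ] (Q : Type u) [Quiver.{u} Q] [Finite Q] [∀ i j : Q, Finite (i ⟶ j)]
    [QuiverRep.IsAcyclic Q] :
    ∃ e : QuiverRep.ProjModTilt Λ Q ≌ (QuiverRep.noInjUnderlying k Λ Q).FullSubcategory,
      (QuiverRep.toProjModTilt Λ Q ⋙ e.functor).Additive ∧
        (QuiverRep.toProjModTilt Λ Q ⋙ e.functor).Linear k := by
  have : IsNoetherianRing Λ := isNoetherian_of_tower k inferInstance
  refine ⟨(QuiverRep.quotientFunctor Λ Q k).asEquivalence, ?_, ?_⟩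
  · exact inferInstanceAs (QuiverRep.stableFunctor Λ Q k).Additive
  · exact inferInstanceAs ((QuiverRep.stableFunctor Λ Q k).Linear k)
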